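/- **Model.** A principal and a myopic agent interact over $T$ rounds. The agent has finitely many solutions $a\in\{1,\dots,K\}$; in round $t$ solution $a$ has utility $X_a^{(t)}\in[0,1]$ for the principal and $Y_a^{(t)}\in[0,1]$ for the agent. The profiles $(X_a^{(t)},Y_a^{(t)})_{a\le K}$, $t=1,2,\dots$, are i.i.d. with a law $D$ (utilities within one round may be correlated). In each round the principal announces a threshold $\tau$, i.e. the eligible set $E_\tau=\{a: X_a^{(t)}\ge\tau\}$; the agent, who sees the profile, chooses an eligible solution or the null outcome (utility $0$ for both) so as to maximise his own utility in that round, ties being broken in favour of the principal. The principal receives and observes her utility $x^{(t)}_{\mathrm{BR}(E_\tau)}$ of the chosen outcome. Let $f(\tau)=\mathbb E\big[x^{(t)}_{\mathrm{BR}(E_\tau)}\big]$. **UCB1.** Given an integer $Q\ge 1$, let arm $i\in\{1,\dots,Q\}$ be the threshold $i/Q$, with reward the principal's utility in that round. UCB1 first pulls every arm once; afterwards, when $n$ rounds have been played, it pulls an arm $i$ maximising $\hat\mu_i+\sqrt{2\log n/n_i}$, where $n_i$ is the number of past pulls of arm $i$ and $\hat\mu_i$ is the average reward received from them (order of the initial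 pulls and ties: any measurable rule depending on the past arms and rewards). Let $x_t$ be the principal's utility in round $t$ and let $$\mathrm{Reg}(T)=T\cdot\max_{\tau\in[0,1]}f(\tau)-\mathbb E\Big[\sum_{t=1}^T x_t\Big].$$ **Theorem.** Suppose that $f$ is upper semicontinuous on $[0,1]$ (for instance continuous), that its maximum over $[0,1]$ is attained at a unique point $\tau^*$, that $\tau^*\in(0,1)$, and that $f$ is differentiable in a neighbourhood of $\tau^*$ and twice differentiable at $\tau^*$ with $f''(\tau^*)<0$. Then there is a constant $C$, depending only on the function $f$, such that for every $T\ge 2$, UCB1 run with $Q=(T/\log T)^{1/4}$, rounded up or down to an integer, satisfies $$\mathrm{Reg}(T)\le C\sqrt{T\log T}.$$ -/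

import Mathlib

open MeasureTheory ProbabilityTheory
open scoped Topology

noncomputable section

namespace RepeatedDelegation

/-! ### The one-round delegation game -/

/-- A realization of the utilities of the agent's `K` solutions in one round:
solution `a` is worth `(s a).1` to the principal and `(s a).2` to the agent. -/
abbrev Profile (K : ℕ) : Type := Fin K → ℝ × ℝ

/-- The principal's utility of an outcome; `none` is the null outcome (nothing is submitted). -/
def principalUtility {K : ℕ} (s : Profile K) : Option (Fin K) → ℝ
  | none => 0
  | some a => (s a).1

/-- The agent's utility of an outcome. -/
def agentUtility {K : ℕ} (s : Profile K) : Option (Fin K) → ℝ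
  | none => 0
  | some a => (s a).2

open Classical in
/-- What the agent can bring about when the eligible set is `E_τ = {a | X_a ≥ τ}`:
the null outcome, or any eligible solution. -/
def feasible {K : ℕ} (s : Profile K) (τ : ℝ) : Finset (Option (Fin K)) :=
  Finset.univ.filter fun o => ∀ a, o = some a → τ ≤ (s a).1

open Classical in
/-- The best responses of the agent to `E_τ`. -/
def bestResponses {K : ℕ} (s : Profile K) (τ : ℝ) : Finset (Option (Fin K)) :=
  (feasible s τ).filter fun o => ∀ o' ∈ feasible s τ, agentUtility s o' ≤ agentUtility s o

theorem bestResponses_nonempty {K : ℕ} (s : Profile K) (τ : ℝ) :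
    (bestResponses s τ).Nonempty := by
  classical
  have hne : (feasible s τ).Nonempty := ⟨none, by simp [feasible]⟩
  obtain ⟨o, ho, hmax⟩ := Finset.exists_max_image (feasible s τ) (agentUtility s) hne
  exact ⟨o, Finset.mem_filter.mpr ⟨ho, hmax⟩⟩

/-- The principal's utility when a myopic agent faces the eligible set `E_τ`: the agent plays a
best response, ties being resolved in favour of the principal. -/
def myopicPayoff {K : ℕ} (s : Profile K) (τ : ℝ) : ℝ :=
  (bestResponses s τ).sup' (bestResponses_nonempty s τ) (principalUtility s)

/-- `f(τ)`: the expected utility of the principal for the threshold `τ` against a myopic agent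
when the profile of utilities has the law `D`. -/
def expectedUtility {K : ℕ} (D : Measure (Profile K)) (τ : ℝ) : ℝ :=
  ∫ s, myopicPayoff s τ ∂D

/-! ### Bandit policies and UCB1 -/

/-- The arms pulled and the rewards received in the first `n` rounds. -/
abbrev History (Q n : ℕ) : Type := Fin n → Fin Q × ℝ

/-- A (deterministic) bandit policy: the next arm as a function of the past. -/
abbrev Policy (Q : ℕ) : Type := (n : ℕ) → History Q n → Fin Q

/-- How often arm `i` has been pulled. -/
def pulls {Q n : ℕ} (h : History Q n) (i : Fin Q) : ℕ :=
  (Finset.univ.filter fun k => (h k).1 = i).card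

/-- The average reward received from arm `i`. -/
def empiricalMean {Q n : ℕ} (h : History Q n) (i : Fin Q) : ℝ :=
  (∑ k ∈ Finset.univ.filter (fun k => (h k).1 = i), (h k).2) / (pulls h i : ℝ)

/-- The UCB1 index of an arm after `n` rounds. -/
def ucbIndex {Q n : ℕ} (h : History Q n) (i : Fin Q) : ℝ :=
  empiricalMean h i + √(2 * Real.log (n : ℝ) / (pulls h i : ℝ))

/-- `π` is UCB1: first pull every arm once (in any order), and afterwards always pull an arm
whose index is maximal (ties are broken by any measurable rule). -/
structure IsUCB1 {Q : ℕ} (π : Policy Q) : Prop where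
  measurable : ∀ n, Measurable (π n)
  explore : ∀ (n : ℕ) (h : History Q n), (∃ j, pulls h j = 0) → pulls h (π n h) = 0
  exploit : ∀ (n : ℕ) (h : History Q n), (∀ j, 0 < pulls h j) →
    ∀ j, ucbIndex h j ≤ ucbIndex h (π n h)

/-- The history that `π` generates when arm `i` pulled in round `t` (rounds are numbered from `0`)
pays `r t i`. -/
def playHistory {Q : ℕ} (π : Policy Q) (r : ℕ → Fin Q → ℝ) : (n : ℕ) → History Q n
  | 0 => Fin.elim0
  | n + 1 => Fin.snoc (α := fun _ => Fin Q × ℝ) (playHistory π r n)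
      (π n (playHistory π r n), r n (π n (playHistory π r n)))

/-- The reward that `π` receives in round `t`. -/
def playReward {Q : ℕ} (π : Policy Q) (r : ℕ → Fin Q → ℝ) (t : ℕ) : ℝ :=
  r t (π t (playHistory π r t))

/-! ### Repeated delegation with discretized thresholds -/

/-- The thresholds `1/Q, 2/Q, …, Q/Q`, one for each arm. -/
def threshold {Q : ℕ} (i : Fin Q) : ℝ := ((i : ℕ) + 1 : ℝ) / (Q : ℝ)

/-- The regret after `T` rounds of announcing thresholds according to `π` against a myopic agent
whose solutions have the utilities `S t ω` in round `t`, relative to the benchmark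
`T · max_{τ ∈ [0,1]} f(τ)`. -/
def regret {K Q : ℕ} {Ω : Type*} [MeasurableSpace Ω] (D : Measure (Profile K)) (μ : Measure Ω)
    (S : ℕ → Ω → Profile K) (π : Policy Q) (T : ℕ) : ℝ :=
  (T : ℝ) * sSup (expectedUtility D '' Set.Icc 0 1) -
    ∫ ω, ∑ t ∈ Finset.range T,
      playReward π (fun t i => myopicPayoff (S t ω) (threshold i)) t ∂μ

end RepeatedDelegation

end

/-!
The regret with respect to `f(τ*)` is the sum over the arms of (loss of the arm) times (expected
number of pulls), because the arm of a round is chosen independently of the utilities of that round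
(`sub_integral_sum_playReward_eq`).

Expected numbers of pulls are bounded as in the classical analysis of UCB1: an arm worse by `Δ` than
some other arm is pulled at most `8 log T / Δ² + 5` times (`IsUCB1.integral_pulls_le`). Rewards are
indexed by rounds and not by pulls, so that the empirical mean of an arm is an average over a random
set of rounds. Its concentration comes from the exponential supermartingale
`exp (l * deviation - l² / 8 * pulls)` (`lintegral_exp_deviation_le_one`, by Hoeffding's lemma)
and Markov's inequality, applied separately for every possible value of the pull count
(`measure_deviates_le`).

At its unique maximum `f` loses at least `c (τ - τ*)²` on all of `[0, 1]`
(`exists_forall_mul_sq_le_sub`) and at most a multiple of `(τ - τ*)²`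
near `τ*` (`exists_forall_sub_le_mul_sq`). Hence some arm of the grid loses only `O(1 / Q²)`. The
arms with a loss of that order cost `O(T / Q²)` altogether; every other arm `i` costs
`O(log T / loss)`, and as the losses grow quadratically with the distance to `τ*`, the sum of
`1 / loss` over the grid is `O(Q²)` (`sum_inv_loss_le`). The choice `Q ≈ (T / log T)^(1/4)` makes
both `T / Q²` and `Q² log T` of order `√(T log T)`.
-/

namespace RepeatedDelegation

/-! ### Pull counts and deviations along a history -/

/-- The accumulated deviation of the rewards received from arm `i` from the value `m`. -/
noncomputable def deviation {Q n : ℕ} (h : History Q n) (i : Fin Q) (m : ℝ) : ℝ :=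
  ∑ k, if (h k).1 = i then (h k).2 - m else 0

theorem pulls_eq_sum {Q n : ℕ} (h : History Q n) (i : Fin Q) :
    pulls h i = ∑ k, if (h k).1 = i then 1 else 0 := by
  rw [pulls, Finset.card_filter]

theorem pulls_le {Q n : ℕ} (h : History Q n) (i : Fin Q) : pulls h i ≤ n :=
  (Finset.card_filter_le _ _).trans (by simp)

theorem pulls_playHistory_succ {Q : ℕ} (π : Policy Q) (r : ℕ → Fin Q → ℝ) (n : ℕ) (i : Fin Q) :
    pulls (playHistory π r (n + 1)) i =
      pulls (playHistory π r n) i + if π n (playHistory π r n) = i then 1 else 0 := by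
  simp only [pulls_eq_sum, playHistory, Fin.sum_univ_castSucc, Fin.snoc_castSucc, Fin.snoc_last]

theorem deviation_playHistory_succ {Q : ℕ} (π : Policy Q) (r : ℕ → Fin Q → ℝ) (n : ℕ)
    (i : Fin Q) (m : ℝ) :
    deviation (playHistory π r (n + 1)) i m =
      deviation (playHistory π r n) i m +
        if π n (playHistory π r n) = i then r n i - m else 0 := by
  simp only [deviation, playHistory, Fin.sum_univ_castSucc, Fin.snoc_castSucc, Fin.snoc_last]
  congr 1
  split_ifs with h <;> simp [h]

theorem empiricalMean_eq {Q n : ℕ} (h : History Q n) (i : Fin Q) (m : ℝ) (hp : 0 < pulls h i) :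
    empiricalMean h i = m + deviation h i m / pulls h i := by
  have hp' : (pulls h i : ℝ) ≠ 0 := by positivity
  have : deviation h i m =
      (∑ k ∈ Finset.univ.filter (fun k => (h k).1 = i), (h k).2) - pulls h i * m := by
    rw [deviation, ← Finset.sum_filter, Finset.sum_sub_distrib]
    simp [pulls]
  rw [empiricalMean, this]
  field_simp
  ring

theorem measurable_pulls {Q n : ℕ} (i : Fin Q) :
    Measurable fun h : History Q n => pulls h i := by
  simp only [pulls_eq_sum]
  refine Finset.measurable_sum _ fun k _ => Measurable.ite ?_ measurable_const measurable_const
  exact (measurable_fst.comp (measurable_pi_apply k)) (measurableSet_singleton i)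

theorem measurable_deviation {Q n : ℕ} (i : Fin Q) (m : ℝ) :
    Measurable fun h : History Q n => deviation h i m := by
  refine Finset.measurable_sum _ fun k _ => Measurable.ite ?_ ?_ measurable_const
  · exact (measurable_fst.comp (measurable_pi_apply k)) (measurableSet_singleton i)
  · exact (measurable_snd.comp (measurable_pi_apply k)).sub_const m

/-- Pulls of arm `i` while its count is at most `u` number at most `u + 1`, so that only the pulls
made at a larger count have to be controlled. -/
theorem pulls_le_add_sum {Q : ℕ} (π : Policy Q) (r : ℕ → Fin Q → ℝ) (i : Fin Q) {u : ℝ}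
    (hu : 0 ≤ u) (T : ℕ) :
    (pulls (playHistory π r T) i : ℝ) ≤ u + 1 + ∑ t ∈ Finset.range T,
      if π t (playHistory π r t) = i ∧ u < pulls (playHistory π r t) i then 1 else 0 := by
  induction T with
  | zero => simp [pulls]; linarith
  | succ n ih =>
    rw [pulls_playHistory_succ, Finset.sum_range_succ]
    by_cases hi : π n (playHistory π r n) = i
    -- A pull at a count of at most `u` leaves the count at most `u + 1`.
    · by_cases hc : u < pulls (playHistory π r n) i
      · simp only [hi, hc, and_self, if_true]; push_cast; linarith
      · have : (0 : ℝ) ≤ ∑ t ∈ Finset.range n,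
            if π t (playHistory π r t) = i ∧ u < pulls (playHistory π r t) i then (1 : ℝ) else 0 :=
          Finset.sum_nonneg fun t _ => by split_ifs <;> norm_num
        simp only [hi, hc, and_false, if_true, if_false]; push_cast; linarith
    · simp only [hi, false_and, if_false]; push_cast; linarith

/-- The event that the rewards of arm `i` deviate from `m` by at least the confidence radius, in
the direction `σ = ±1`. Both failures of the confidence bounds of UCB1 have this form. -/
def Deviates {Q n : ℕ} (h : History Q n) (i : Fin Q) (m σ : ℝ) : Prop :=
  0 < pulls h i ∧ pulls h i * √(2 * Real.log n / pulls h i) ≤ σ * deviation h i m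

/-- UCB1 pulls an arm that is worse by `m' - m` and has already been pulled more than
`8 log n / (m' - m)²` times only when one of the two confidence bounds fails. -/
theorem IsUCB1.deviates {Q : ℕ} {π : Policy Q} (hπ : IsUCB1 π) {n : ℕ} (h : History Q n)
    {i j : Fin Q} {m m' u : ℝ} (hm : m < m') (hu0 : 0 ≤ u)
    (hu : 8 * Real.log n / (m' - m) ^ 2 ≤ u) (hi : π n h = i) (hpu : u < pulls h i) :
    Deviates h i m 1 ∨ Deviates h j m' (-1) := by
  have hpi : 0 < pulls h i := by exact_mod_cast hu0.trans_lt hpu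
  -- The exploration phase is over, since UCB1 pulls an arm that has been pulled before.
  have hall : ∀ k, 0 < pulls h k := by
    intro k
    by_contra hk
    have := hπ.explore n h ⟨k, by omega⟩
    rw [hi] at this; omega
  have hucb := hπ.exploit n h hall j
  rw [hi] at hucb
  have hpj := hall j
  have hpi' : (0 : ℝ) < pulls h i := by exact_mod_cast hpi
  have hpj' : (0 : ℝ) < pulls h j := by exact_mod_cast hpj
  by_contra hcon
  simp only [Deviates, not_or, not_and, not_le] at hcon
  have h1 := hcon.1 hpi
  have h2 := hcon.2 hpj
  rw [ucbIndex, ucbIndex, empiricalMean_eq h i m hpi, empiricalMean_eq h j m' hpj] at hucb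
  set ci := √(2 * Real.log n / pulls h i) with hci
  set cj := √(2 * Real.log n / pulls h j)
  have h1' : deviation h i m / pulls h i < ci := by
    rw [div_lt_iff₀ hpi']; linarith
  have h2' : -cj < deviation h j m' / pulls h j := by
    rw [lt_div_iff₀ hpj']; linarith
  -- Both confidence bounds hold: `m' < index of j ≤ index of i < m + 2 ci`.
  have hgap : m' - m < 2 * ci := by linarith
  have hsq : (m' - m) ^ 2 < 4 * ci ^ 2 := by nlinarith
  have hlog : 0 ≤ Real.log n := Real.log_natCast_nonneg n
  rw [hci, Real.sq_sqrt (by positivity)] at hsq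
  have hd : 0 < (m' - m) ^ 2 := by have := sub_pos.2 hm; positivity
  have : (pulls h i : ℝ) < 8 * Real.log n / (m' - m) ^ 2 := by
    rw [lt_div_iff₀ hd]
    have h3 : 4 * (2 * Real.log n / pulls h i) * pulls h i = 8 * Real.log n := by
      field_simp; ring
    nlinarith
  linarith

/-! ### Independence of the past and the current round -/

theorem measurable_policy_apply {Q : ℕ} {Ω : Type*} {π : Policy Q} (hπ : ∀ n, Measurable (π n))
    {mΩ : MeasurableSpace Ω} {n : ℕ} {H : Ω → History Q n} (hH : Measurable H) :
    Measurable fun ω => π n (H ω) :=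
  (hπ n).comp hH

theorem measurable_eval_arm {Q : ℕ} {Ω : Type*} {mΩ : MeasurableSpace Ω}
    {g : Fin Q → Ω → ℝ} (hg : ∀ i, Measurable (g i))
    {I : Ω → Fin Q} (hI : Measurable I) : Measurable fun ω => g (I ω) ω := by
  have : (fun ω => g (I ω) ω) = fun ω => ∑ i, if I ω = i then g i ω else 0 := by
    ext ω; simp
  rw [this]
  exact Finset.measurable_sum _ fun i _ =>
    Measurable.ite (hI (measurableSet_singleton i)) (hg i) measurable_const

/-- The history of the first `n` rounds is a function of the first `n` states. -/
theorem measurable_playHistory_past {Q : ℕ} {E Ω : Type*} [MeasurableSpace E]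
    {π : Policy Q} (hπ : ∀ n, Measurable (π n))
    {ρ : Fin Q → E → ℝ} (hρ : ∀ i, Measurable (ρ i)) (X : ℕ → Ω → E) (n : ℕ) :
    Measurable[⨆ t ∈ Set.Iio n, MeasurableSpace.comap (X t) inferInstance]
      fun ω => playHistory π (fun t i => ρ i (X t ω)) n := by
  induction n with
  | zero => simp only [playHistory]; exact @measurable_const _ _ _ _ _
  | succ n ih =>
    have hle : (⨆ t ∈ Set.Iio n, MeasurableSpace.comap (X t) inferInstance) ≤
        ⨆ t ∈ Set.Iio (n + 1), MeasurableSpace.comap (X t) inferInstance :=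
      biSup_mono fun t ht => Set.mem_Iio.2 (lt_trans (Set.mem_Iio.1 ht) (Nat.lt_succ_self n))
    have ih' := ih.mono hle le_rfl
    have hX : Measurable[⨆ t ∈ Set.Iio (n + 1), MeasurableSpace.comap (X t) inferInstance] (X n) :=
      Measurable.mono (comap_measurable (X n))
        (le_biSup (fun t => MeasurableSpace.comap (X t) inferInstance)
          (Set.mem_Iio.2 (Nat.lt_succ_self n))) le_rfl
    have hI := measurable_policy_apply (mΩ := ⨆ t ∈ Set.Iio (n + 1),
      MeasurableSpace.comap (X t) inferInstance) hπ ih'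
    have hr := measurable_eval_arm (mΩ := ⨆ t ∈ Set.Iio (n + 1),
      MeasurableSpace.comap (X t) inferInstance) (fun i => (hρ i).comp hX) hI
    refine @measurable_pi_lambda _ _ _ (_) _ _ fun k => ?_
    refine Fin.lastCases ?_ (fun k => ?_) k
    · simp only [playHistory, Fin.snoc_last]
      exact @Measurable.prodMk _ _ _ _ _ (_) _ _ hI hr
    · simp only [playHistory, Fin.snoc_castSucc]
      exact (measurable_pi_apply k).comp ih'

section Stochastic

variable {Q : ℕ} {E Ω : Type*} [MeasurableSpace E] [MeasurableSpace Ω]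

theorem measurable_playHistory {π : Policy Q} (hπ : ∀ n, Measurable (π n))
    {ρ : Fin Q → E → ℝ} (hρ : ∀ i, Measurable (ρ i)) {X : ℕ → Ω → E} (hX : ∀ t, Measurable (X t))
    (n : ℕ) : Measurable fun ω => playHistory π (fun t i => ρ i (X t ω)) n :=
  (measurable_playHistory_past hπ hρ X n).mono (iSup₂_le fun t _ => (hX t).comap_le) le_rfl

theorem indepFun_playHistory {μ : Measure Ω} {π : Policy Q} (hπ : ∀ n, Measurable (π n))
    {ρ : Fin Q → E → ℝ} (hρ : ∀ i, Measurable (ρ i)) {X : ℕ → Ω → E} (hX : ∀ t, Measurable (X t))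
    (hind : iIndepFun X μ) (n : ℕ) :
    IndepFun (fun ω => playHistory π (fun t i => ρ i (X t ω)) n) (X n) μ := by
  have h := indep_iSup_of_disjoint (fun t => (hX t).comap_le) hind.iIndep
    (S := Set.Iio n) (T := {n}) (by simp)
  rw [IndepFun_iff_Indep]
  refine indep_of_indep_of_le_left (indep_of_indep_of_le_right h ?_)
    (measurable_playHistory_past hπ hρ X n).comap_le
  simp

/-- The joint law of the history and the current state is a product. -/
theorem map_playHistory_prod {μ : Measure Ω} [IsProbabilityMeasure μ] {D : Measure E}
    {π : Policy Q} (hπ : ∀ n, Measurable (π n))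
    {ρ : Fin Q → E → ℝ} (hρ : ∀ i, Measurable (ρ i)) {X : ℕ → Ω → E} (hX : ∀ t, Measurable (X t))
    (hind : iIndepFun X μ) (hD : ∀ t, μ.map (X t) = D) (n : ℕ) :
    μ.map (fun ω => (playHistory π (fun t i => ρ i (X t ω)) n, X n ω)) =
      (μ.map fun ω => playHistory π (fun t i => ρ i (X t ω)) n).prod D := by
  rw [← hD n]
  exact (indepFun_iff_map_prod_eq_prod_map_map
    (measurable_playHistory hπ hρ hX n).aemeasurable (hX n).aemeasurable).1
    (indepFun_playHistory hπ hρ hX hind n)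

/-- The expected reward of a round is the expected mean of the arm pulled in it. -/
theorem integral_playReward {μ : Measure Ω} [IsProbabilityMeasure μ] {D : Measure E}
    [IsProbabilityMeasure D] {π : Policy Q} (hπ : ∀ n, Measurable (π n))
    {ρ : Fin Q → E → ℝ} (hρ : ∀ i, Measurable (ρ i))
    (hρ01 : ∀ i, ∀ᵐ s ∂D, ρ i s ∈ Set.Icc (0 : ℝ) 1)
    {X : ℕ → Ω → E} (hX : ∀ t, Measurable (X t))
    (hind : iIndepFun X μ) (hD : ∀ t, μ.map (X t) = D) (n : ℕ) :
    Integrable (fun ω => playReward π (fun t i => ρ i (X t ω)) n) μ ∧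
    ∫ ω, playReward π (fun t i => ρ i (X t ω)) n ∂μ =
      ∫ ω, ∫ s, ρ (π n (playHistory π (fun t i => ρ i (X t ω)) n)) s ∂D ∂μ := by
  have hH := measurable_playHistory hπ hρ hX n
  have hpair := (hH.prodMk (hX n)).aemeasurable (μ := μ)
  have hg : Measurable fun p : History Q n × E => ρ (π n p.1) p.2 :=
    measurable_eval_arm (fun i => (hρ i).comp measurable_snd) ((hπ n).comp measurable_fst)
  have hmap := map_playHistory_prod hπ hρ hX hind hD n
  have : IsProbabilityMeasure (μ.map fun ω => playHistory π (fun t i => ρ i (X t ω)) n) :=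
    Measure.isProbabilityMeasure_map hH.aemeasurable
  have hint : Integrable (fun p : History Q n × E => ρ (π n p.1) p.2)
      ((μ.map fun ω => playHistory π (fun t i => ρ i (X t ω)) n).prod D) := by
    refine Integrable.of_mem_Icc 0 1 hg.aemeasurable ?_
    exact (Measure.ae_prod_mem_iff_ae_ae_mem (hg measurableSet_Icc)).2
      (ae_of_all _ fun h => hρ01 (π n h))
  constructor
  · rw [← hmap] at hint
    exact hint.comp_aemeasurable hpair
  · have h1 : ∫ ω, playReward π (fun t i => ρ i (X t ω)) n ∂μ =
        ∫ p, ρ (π n p.1) p.2 ∂(μ.map fun ω =>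
          (playHistory π (fun t i => ρ i (X t ω)) n, X n ω)) :=
      (integral_map hpair hg.aestronglyMeasurable).symm
    rw [h1, hmap, integral_prod _ hint, integral_map hH.aemeasurable]
    exact hint.integral_prod_left.aestronglyMeasurable

/-! ### Concentration of the empirical means -/

/-- Along the play, `exp (l * deviation - l² / 8 * pulls)` is a supermartingale started at `1`. -/
theorem lintegral_exp_deviation_le_one {μ : Measure Ω} [IsProbabilityMeasure μ] {D : Measure E}
    [IsProbabilityMeasure D] {π : Policy Q} (hπ : ∀ n, Measurable (π n))
    {ρ : Fin Q → E → ℝ} (hρ : ∀ i, Measurable (ρ i))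
    (hρ01 : ∀ i, ∀ᵐ s ∂D, ρ i s ∈ Set.Icc (0 : ℝ) 1)
    {X : ℕ → Ω → E} (hX : ∀ t, Measurable (X t))
    (hind : iIndepFun X μ) (hD : ∀ t, μ.map (X t) = D) (i : Fin Q) (l : ℝ) (n : ℕ) :
    ∫⁻ ω, ENNReal.ofReal (Real.exp (
      l * deviation (playHistory π (fun t i => ρ i (X t ω)) n) i (∫ s, ρ i s ∂D) -
        l ^ 2 / 8 * pulls (playHistory π (fun t i => ρ i (X t ω)) n) i)) ∂μ ≤ 1 := by
  set m := ∫ s, ρ i s ∂D with hm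
  -- Hoeffding's lemma for one reward.
  have hstep : ∫⁻ s, ENNReal.ofReal (Real.exp (l * (ρ i s - m) - l ^ 2 / 8)) ∂D ≤ 1 := by
    have hsub := hasSubgaussianMGF_of_mem_Icc (hρ i).aemeasurable (hρ01 i)
    have hint := (hsub.integrable_exp_mul l).mul_const (Real.exp (-(l ^ 2 / 8)))
    have hle := hsub.mgf_le l
    simp only [sub_eq_add_neg _ (l ^ 2 / 8), Real.exp_add]
    rw [← ofReal_integral_eq_lintegral_ofReal hint (ae_of_all _ fun s => by positivity),
      integral_mul_const, ENNReal.ofReal_le_one]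
    calc _ ≤ Real.exp (l ^ 2 / 8) * Real.exp (-(l ^ 2 / 8)) := by
          refine mul_le_mul_of_nonneg_right (hle.trans_eq ?_) (Real.exp_pos _).le
          congr 1
          simp
          ring
      _ = 1 := by rw [← Real.exp_add]; simp
  induction n with
  | zero => simp [playHistory, deviation, pulls]
  | succ n ih =>
    have hH := measurable_playHistory hπ hρ hX n
    let A : History Q n → ENNReal := fun h =>
      ENNReal.ofReal (Real.exp (l * deviation h i m - l ^ 2 / 8 * pulls h i))
    let B : History Q n × E → ENNReal := fun p => if π n p.1 = i then
      ENNReal.ofReal (Real.exp (l * (ρ i p.2 - m) - l ^ 2 / 8)) else 1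
    have hA : Measurable A := by
      have h1 := measurable_deviation (n := n) i m
      have h2 : Measurable fun h : History Q n => (pulls h i : ℝ) :=
        measurable_from_nat.comp (measurable_pulls i)
      fun_prop
    have hB : Measurable B := by
      refine Measurable.ite (((hπ n).comp measurable_fst) (measurableSet_singleton i)) ?_
        measurable_const
      have := hρ i
      fun_prop
    have hAB : Measurable fun p : History Q n × E => A p.1 * B p := by fun_prop
    calc _ = ∫⁻ ω, (fun p : History Q n × E => A p.1 * B p)
          (playHistory π (fun t i => ρ i (X t ω)) n, X n ω) ∂μ := by
          refine lintegral_congr fun ω => ?_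
          simp only [A, B, deviation_playHistory_succ, pulls_playHistory_succ]
          split_ifs
          · rw [← ENNReal.ofReal_mul (Real.exp_pos _).le, ← Real.exp_add]
            push_cast
            ring_nf
          · simp
      _ = ∫⁻ h, ∫⁻ s, A h * B (h, s) ∂D
            ∂(μ.map fun ω => playHistory π (fun t i => ρ i (X t ω)) n) := by
          rw [← lintegral_map hAB (hH.prodMk (hX n)), map_playHistory_prod hπ hρ hX hind hD n,
            lintegral_prod _ hAB.aemeasurable]
      _ ≤ ∫⁻ h, A h ∂(μ.map fun ω => playHistory π (fun t i => ρ i (X t ω)) n) := by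
          refine lintegral_mono fun h => ?_
          rw [lintegral_const_mul _ (by fun_prop)]
          refine (mul_le_mul_right ?_ _).trans_eq (mul_one _)
          by_cases hi : π n h = i <;> simp [B, hi, hstep]
      _ ≤ 1 := by rwa [lintegral_map hA hH]

theorem measurableSet_deviates {n : ℕ} (i : Fin Q) (m σ : ℝ) :
    MeasurableSet {h : History Q n | Deviates h i m σ} := by
  have h1 := measurable_deviation (n := n) i m
  have h2 : Measurable fun h : History Q n => (pulls h i : ℝ) :=
    measurable_from_nat.comp (measurable_pulls i)
  refine MeasurableSet.inter (measurable_pulls i (measurableSet_Ioi (a := 0))) ?_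
  exact measurableSet_le (h2.mul (h2.const_div _).sqrt) (h1.const_mul σ)

/-- Union bound over the number of pulls: for each value `k ≤ n` of the count, the exponential
supermartingale and Markov's inequality bound the probability by `n⁻⁴`. For `n = 0` no arm has been
pulled, and both sides are `0`. -/
theorem measure_deviates_le {μ : Measure Ω} [IsProbabilityMeasure μ] {D : Measure E}
    [IsProbabilityMeasure D] {π : Policy Q} (hπ : ∀ n, Measurable (π n))
    {ρ : Fin Q → E → ℝ} (hρ : ∀ i, Measurable (ρ i))
    (hρ01 : ∀ i, ∀ᵐ s ∂D, ρ i s ∈ Set.Icc (0 : ℝ) 1)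
    {X : ℕ → Ω → E} (hX : ∀ t, Measurable (X t))
    (hind : iIndepFun X μ) (hD : ∀ t, μ.map (X t) = D) (i : Fin Q) {σ : ℝ} (hσ : σ ^ 2 = 1)
    (n : ℕ) :
    μ.real {ω | Deviates (playHistory π (fun t i => ρ i (X t ω)) n) i (∫ s, ρ i s ∂D) σ} ≤
      ((n : ℝ) ^ 3)⁻¹ := by
  rcases Nat.eq_zero_or_pos n with rfl | hn
  · simp [Deviates, pulls]
  have hn' : (0 : ℝ) < n := by exact_mod_cast hn
  set m := ∫ s, ρ i s ∂D
  let c : ℕ → ℝ := fun k => √(2 * Real.log n / k)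
  -- On the event with pull count `k` the exponent `l * (k c) - l² k / 8` is maximal at `l = 4 c`,
  -- where it equals `2 k c² = 4 log n`.
  let Z : ℕ → Ω → ENNReal := fun k ω => ENNReal.ofReal (Real.exp (
      (4 * σ * c k) * deviation (playHistory π (fun t i => ρ i (X t ω)) n) i m -
        (4 * σ * c k) ^ 2 / 8 * pulls (playHistory π (fun t i => ρ i (X t ω)) n) i))
  have hZ : ∀ k, Measurable (Z k) := fun k => by
    have hH := measurable_playHistory hπ hρ hX n
    have h1 := (measurable_deviation (n := n) i m).comp hH
    have h2 : Measurable fun ω =>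
        (pulls (playHistory π (fun t i => ρ i (X t ω)) n) i : ℝ) :=
      measurable_from_nat.comp ((measurable_pulls (n := n) i).comp hH)
    simp only [Function.comp_def] at h1
    fun_prop
  have hmarkov : ∀ k, μ {ω | ENNReal.ofReal ((n : ℝ) ^ 4) ≤ Z k ω} ≤
      ENNReal.ofReal (((n : ℝ) ^ 4)⁻¹) := fun k => by
    have h := meas_ge_le_lintegral_div (μ := μ) (hZ k).aemeasurable
      (ε := ENNReal.ofReal ((n : ℝ) ^ 4)) (by simp; positivity) ENNReal.ofReal_ne_top
    refine h.trans ?_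
    rw [ENNReal.ofReal_inv_of_pos (by positivity), div_eq_mul_inv]
    refine (mul_le_mul_left (lintegral_exp_deviation_le_one hπ hρ hρ01 hX hind hD i _ n) _).trans ?_
    simp
  have hsub : {ω | Deviates (playHistory π (fun t i => ρ i (X t ω)) n) i m σ} ⊆
      ⋃ k ∈ Finset.Icc 1 n, {ω | ENNReal.ofReal ((n : ℝ) ^ 4) ≤ Z k ω} := by
    rintro ω ⟨hp, hdev⟩
    simp only [Set.mem_iUnion]
    set h := playHistory π (fun t i => ρ i (X t ω)) n with hh
    refine ⟨pulls h i, Finset.mem_Icc.2 ⟨hp, pulls_le h i⟩, ?_⟩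
    have hp' : (0 : ℝ) < pulls h i := by exact_mod_cast hp
    have hlog : 0 ≤ Real.log n := Real.log_natCast_nonneg n
    have hc0 : 0 ≤ c (pulls h i) := Real.sqrt_nonneg _
    have hc : c (pulls h i) ^ 2 * pulls h i = 2 * Real.log n := by
      simp only [c]; rw [Real.sq_sqrt (by positivity)]; field_simp
    refine ENNReal.ofReal_le_ofReal ?_
    rw [← Real.exp_log (show (0 : ℝ) < (n : ℝ) ^ 4 by positivity), Real.log_pow]
    refine Real.exp_le_exp.2 ?_
    rw [← hh]
    have h1 : pulls h i * c (pulls h i) ≤ σ * deviation h i m := hdev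
    have h2 := mul_le_mul_of_nonneg_left h1 hc0
    have h3 : (4 * σ * c (pulls h i)) ^ 2 / 8 * pulls h i = 4 * Real.log n := by
      calc _ = 2 * σ ^ 2 * (c (pulls h i) ^ 2 * pulls h i) := by ring
        _ = _ := by rw [hσ, hc]; ring
    rw [h3]
    push_cast
    nlinarith
  have hmeas : μ {ω | Deviates (playHistory π (fun t i => ρ i (X t ω)) n) i m σ} ≤
      ENNReal.ofReal (((n : ℝ) ^ 3)⁻¹) := by
    refine (measure_mono hsub).trans ((measure_biUnion_finset_le _ _).trans ?_)
    refine (Finset.sum_le_sum fun k _ => hmarkov k).trans_eq ?_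
    rw [Finset.sum_const, Nat.card_Icc, nsmul_eq_mul, Nat.add_sub_cancel, ← ENNReal.ofReal_natCast,
      ← ENNReal.ofReal_mul hn'.le]
    congr 1
    field_simp
  exact ENNReal.toReal_le_of_le_ofReal (by positivity) hmeas

/-- The term at `t = 0` is `0⁻¹ = 0`. -/
theorem sum_range_inv_cube_le (T : ℕ) : ∑ t ∈ Finset.range T, ((t : ℝ) ^ 3)⁻¹ ≤ 2 := by
  calc ∑ t ∈ Finset.range T, ((t : ℝ) ^ 3)⁻¹ ≤ ∑ t ∈ Finset.Ioo 0 T, ((t : ℝ) ^ 2)⁻¹ := by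
        rw [← Finset.sum_filter_add_sum_filter_not (Finset.range T) (fun t => t = 0)]
        have h0 : ∑ t ∈ (Finset.range T).filter (fun t => t = 0), ((t : ℝ) ^ 3)⁻¹ = 0 :=
          Finset.sum_eq_zero fun t ht => by simp [(Finset.mem_filter.1 ht).2]
        have hs : (Finset.range T).filter (fun t => ¬ t = 0) = Finset.Ioo 0 T := by
          ext t; simp; omega
        rw [h0, zero_add, hs]
        refine Finset.sum_le_sum fun t ht => ?_
        have : (1 : ℝ) ≤ t := by exact_mod_cast (Finset.mem_Ioo.1 ht).1
        gcongr
        norm_num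
    _ ≤ 2 := (sum_Ioo_inv_sq_le 0 T).trans (by norm_num)

theorem integrable_pulls {μ : Measure Ω} [IsProbabilityMeasure μ]
    {π : Policy Q} (hπ : ∀ n, Measurable (π n))
    {ρ : Fin Q → E → ℝ} (hρ : ∀ i, Measurable (ρ i))
    {X : ℕ → Ω → E} (hX : ∀ t, Measurable (X t)) (i : Fin Q) (T : ℕ) :
    Integrable (fun ω => (pulls (playHistory π (fun t i => ρ i (X t ω)) T) i : ℝ)) μ := by
  refine Integrable.of_mem_Icc 0 T ?_ (ae_of_all _ fun ω => ⟨by positivity, ?_⟩)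
  · exact (measurable_from_nat.comp
      ((measurable_pulls i).comp (measurable_playHistory hπ hρ hX T))).aemeasurable
  · exact_mod_cast pulls_le _ i

/-- The classical bound for UCB1: in expectation an arm whose mean is smaller by `Δ` than that of
some other arm is pulled at most `8 log T / Δ² + 5` times. -/
theorem IsUCB1.integral_pulls_le {μ : Measure Ω} [IsProbabilityMeasure μ] {D : Measure E}
    [IsProbabilityMeasure D] {π : Policy Q} (hπ : IsUCB1 π)
    {ρ : Fin Q → E → ℝ} (hρ : ∀ i, Measurable (ρ i))
    (hρ01 : ∀ i, ∀ᵐ s ∂D, ρ i s ∈ Set.Icc (0 : ℝ) 1)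
    {X : ℕ → Ω → E} (hX : ∀ t, Measurable (X t))
    (hind : iIndepFun X μ) (hD : ∀ t, μ.map (X t) = D) {i j : Fin Q}
    (hij : ∫ s, ρ i s ∂D < ∫ s, ρ j s ∂D) (T : ℕ) :
    ∫ ω, (pulls (playHistory π (fun t i => ρ i (X t ω)) T) i : ℝ) ∂μ ≤
      8 * Real.log T / (∫ s, ρ j s ∂D - ∫ s, ρ i s ∂D) ^ 2 + 5 := by
  set m := ∫ s, ρ i s ∂D with hm
  set m' := ∫ s, ρ j s ∂D with hm'
  set u := 8 * Real.log T / (m' - m) ^ 2 with hu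
  have hu0 : 0 ≤ u := by have := Real.log_natCast_nonneg T; positivity
  let B₁ : ℕ → Set Ω := fun t =>
    {ω | Deviates (playHistory π (fun t i => ρ i (X t ω)) t) i m 1}
  let B₂ : ℕ → Set Ω := fun t =>
    {ω | Deviates (playHistory π (fun t i => ρ i (X t ω)) t) j m' (-1)}
  have hB₁ : ∀ t, MeasurableSet (B₁ t) := fun t =>
    measurable_playHistory hπ.measurable hρ hX t (measurableSet_deviates i m 1)
  have hB₂ : ∀ t, MeasurableSet (B₂ t) := fun t =>
    measurable_playHistory hπ.measurable hρ hX t (measurableSet_deviates j m' (-1))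
  have hpt : ∀ ω, (pulls (playHistory π (fun t i => ρ i (X t ω)) T) i : ℝ) ≤
      (u + 1) + ∑ t ∈ Finset.range T,
        ((B₁ t).indicator (fun _ => (1 : ℝ)) ω + (B₂ t).indicator (fun _ => (1 : ℝ)) ω) := by
    intro ω
    refine (pulls_le_add_sum π _ i hu0 T).trans ?_
    gcongr with t ht
    have h1 : 0 ≤ (B₁ t).indicator (fun _ => (1 : ℝ)) ω :=
      Set.indicator_nonneg (fun _ _ => zero_le_one) _
    have h2 : 0 ≤ (B₂ t).indicator (fun _ => (1 : ℝ)) ω :=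
      Set.indicator_nonneg (fun _ _ => zero_le_one) _
    split_ifs with hc
    · have htT : 8 * Real.log t / (m' - m) ^ 2 ≤ u := by
        have : Real.log t ≤ Real.log T := by
          rcases Nat.eq_zero_or_pos t with rfl | h0
          · simpa using Real.log_natCast_nonneg T
          · exact Real.log_le_log (by exact_mod_cast h0)
              (by exact_mod_cast (Finset.mem_range.1 ht).le)
        rw [hu]; gcongr
      rcases hπ.deviates (j := j) _ hij hu0 htT hc.1 hc.2 with h | h
      · rw [Set.indicator_of_mem (s := B₁ t) h]; linarith
      · rw [Set.indicator_of_mem (s := B₂ t) h]; linarith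
    · linarith
  have hi₁ : ∀ t, Integrable ((B₁ t).indicator (fun _ => (1 : ℝ))) μ := fun t =>
    (integrable_const 1).indicator (hB₁ t)
  have hi₂ : ∀ t, Integrable ((B₂ t).indicator (fun _ => (1 : ℝ))) μ := fun t =>
    (integrable_const 1).indicator (hB₂ t)
  have hi : ∀ t, Integrable (fun ω =>
      (B₁ t).indicator (fun _ => (1 : ℝ)) ω + (B₂ t).indicator (fun _ => (1 : ℝ)) ω) μ := fun t =>
    (hi₁ t).add (hi₂ t)
  have hisum : Integrable (fun ω => ∑ t ∈ Finset.range T,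
      ((B₁ t).indicator (fun _ => (1 : ℝ)) ω + (B₂ t).indicator (fun _ => (1 : ℝ)) ω)) μ :=
    integrable_finsetSum _ fun t _ => hi t
  refine (integral_mono (integrable_pulls hπ.measurable hρ hX i T)
    ((integrable_const _).add hisum) hpt).trans ?_
  rw [integral_add' (integrable_const _) hisum, integral_finsetSum _ fun t _ => hi t]
  have hterm : ∀ t, ∫ ω, ((B₁ t).indicator (fun _ => (1 : ℝ)) ω +
      (B₂ t).indicator (fun _ => (1 : ℝ)) ω) ∂μ ≤ 2 * ((t : ℝ) ^ 3)⁻¹ := fun t => by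
    rw [integral_add (hi₁ t) (hi₂ t), integral_indicator_const _ (hB₁ t),
      integral_indicator_const _ (hB₂ t)]
    have h1 := measure_deviates_le hπ.measurable hρ hρ01 hX hind hD i (σ := 1) (by norm_num) t
    have h2 := measure_deviates_le hπ.measurable hρ hρ01 hX hind hD j (σ := -1) (by norm_num) t
    simp only [smul_eq_mul, mul_one]
    linarith
  have hsum := Finset.sum_le_sum fun t (_ : t ∈ Finset.range T) => hterm t
  rw [← Finset.mul_sum] at hsum
  have := sum_range_inv_cube_le T
  simp only [integral_const, probReal_univ, one_smul]
  linarith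

end Stochastic

/-! ### Quadratic behaviour of the expected utility at its maximum -/

/-- If `f''(x₀) + 2c < 0` then adding `c (x - x₀)²` does not destroy the local maximum at a
critical point `x₀`. -/
theorem isLocalMax_add_sq {f : ℝ → ℝ} {x₀ c : ℝ} (hd0 : deriv f x₀ = 0)
    (hdiff : ∀ᶠ x in 𝓝 x₀, DifferentiableAt ℝ f x) (hdiff₂ : DifferentiableAt ℝ (deriv f) x₀)
    (hneg : deriv (deriv f) x₀ + 2 * c < 0) :
    IsLocalMax (fun x => f x + c * (x - x₀) ^ 2) x₀ := by
  have hq : ∀ x, HasDerivAt (fun x => c * (x - x₀) ^ 2) (2 * c * (x - x₀)) x := fun x => by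
    have := (((hasDerivAt_id x).sub_const x₀).pow 2).const_mul c
    refine this.congr_deriv ?_
    simp
    ring
  have hq₂ : HasDerivAt (fun x => 2 * c * (x - x₀)) (2 * c) x₀ := by
    simpa using ((hasDerivAt_id x₀).sub_const x₀).const_mul (2 * c)
  have hderiv : deriv (fun x => f x + c * (x - x₀) ^ 2) =ᶠ[𝓝 x₀]
      fun x => deriv f x + 2 * c * (x - x₀) := by
    filter_upwards [hdiff] with x hx
    exact (hx.hasDerivAt.add (hq x)).deriv
  apply isLocalMax_of_deriv_deriv_neg
  · rw [hderiv.deriv_eq]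
    exact (hdiff₂.hasDerivAt.add hq₂).deriv.trans_lt hneg
  · rw [hderiv.eq_of_nhds, hd0]; simp
  · exact (hdiff.self_of_nhds.hasDerivAt.add (hq x₀)).continuousAt

/-- Near a critical point with `f'' < 0` the loss is at most quadratic. -/
theorem exists_forall_sub_le_mul_sq {f : ℝ → ℝ} {x₀ : ℝ} (hd0 : deriv f x₀ = 0)
    (hdiff : ∀ᶠ x in 𝓝 x₀, DifferentiableAt ℝ f x) (hdiff₂ : DifferentiableAt ℝ (deriv f) x₀) :
    ∃ A > 0, ∃ δ > 0, ∀ x, |x - x₀| < δ → f x₀ - f x ≤ A * (x - x₀) ^ 2 := by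
  have hd : deriv (fun x => -f x) = fun x => -deriv f x := by ext x; simp
  set A := |deriv (deriv f) x₀| + 1 with hA
  have hmax : IsLocalMax (fun x => -f x + (-A) * (x - x₀) ^ 2) x₀ := by
    refine isLocalMax_add_sq (by simp [hd0]) (hdiff.mono fun x hx => hx.neg)
      (by rw [hd]; exact hdiff₂.neg) ?_
    rw [hd]
    simp only [deriv.fun_neg]
    have := neg_abs_le (deriv (deriv f) x₀)
    have := abs_nonneg (deriv (deriv f) x₀)
    linarith
  obtain ⟨δ, hδ, h⟩ := Metric.eventually_nhds_iff.1 hmax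
  refine ⟨A, by positivity, δ, hδ, fun x hx => ?_⟩
  have := h (by rwa [Real.dist_eq])
  simp only [sub_self] at this
  nlinarith

/-- A unique maximiser with `f'' < 0` of an upper semicontinuous function on `[0, 1]`: the loss is
at least quadratic on the whole interval. -/
theorem exists_forall_mul_sq_le_sub {f : ℝ → ℝ} {x₀ : ℝ} (hx₀ : x₀ ∈ Set.Ioo (0 : ℝ) 1)
    (hunique : ∀ x ∈ Set.Icc (0 : ℝ) 1, x ≠ x₀ → f x < f x₀)
    (husc : UpperSemicontinuousOn f (Set.Icc 0 1)) (hd0 : deriv f x₀ = 0)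
    (hdiff : ∀ᶠ x in 𝓝 x₀, DifferentiableAt ℝ f x) (hdiff₂ : DifferentiableAt ℝ (deriv f) x₀)
    (hneg : deriv (deriv f) x₀ < 0) :
    ∃ c > 0, ∀ x ∈ Set.Icc (0 : ℝ) 1, c * (x - x₀) ^ 2 ≤ f x₀ - f x := by
  set c := -deriv (deriv f) x₀ / 4 with hc
  have hc0 : 0 < c := by linarith
  have hmax := isLocalMax_add_sq (c := c) hd0 hdiff hdiff₂ (by linarith)
  obtain ⟨δ, hδ, h⟩ := Metric.eventually_nhds_iff.1 hmax
  have hnear : ∀ x, |x - x₀| < δ → c * (x - x₀) ^ 2 ≤ f x₀ - f x := fun x hx => by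
    have := h (by rwa [Real.dist_eq])
    simp only [sub_self] at this
    nlinarith
  -- Away from `x₀` the supremum over a compact set is attained, so it stays below `f x₀`.
  have hK : IsCompact (Set.Icc (0 : ℝ) 1 \ Metric.ball x₀ δ) :=
    isCompact_Icc.diff Metric.isOpen_ball
  rcases (Set.Icc (0 : ℝ) 1 \ Metric.ball x₀ δ).eq_empty_or_nonempty with hK0 | hK0
  · refine ⟨c, hc0, fun x hx => hnear x ?_⟩
    have := Set.sdiff_eq_empty.1 hK0 hx
    rwa [Metric.mem_ball, Real.dist_eq] at this
  obtain ⟨y, hy, hymax⟩ := (husc.mono Set.sdiff_subset).exists_isMaxOn hK0 hK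
  have hy0 : f y < f x₀ := hunique y hy.1 fun h => hy.2 (by simpa [h] using hδ)
  refine ⟨min c (f x₀ - f y), lt_min hc0 (by linarith), fun x hx => ?_⟩
  by_cases hxδ : |x - x₀| < δ
  · exact (mul_le_mul_of_nonneg_right (min_le_left _ _) (sq_nonneg _)).trans (hnear x hxδ)
  · have hxy : f x ≤ f y := hymax (Set.mem_sdiff_of_mem hx (by
      rwa [Metric.mem_ball, Real.dist_eq]))
    have hsq : (x - x₀) ^ 2 ≤ 1 := by
      rw [sq_le_one_iff_abs_le_one, abs_le]
      constructor <;> linarith [hx.1, hx.2, hx₀.1, hx₀.2]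
    have := mul_le_mul_of_nonneg_right (min_le_right c (f x₀ - f y)) (sq_nonneg (x - x₀))
    nlinarith

/-! ### The grid of thresholds -/

theorem sum_range_inv_one_add_sq_le (n : ℕ) :
    ∑ k ∈ Finset.range n, (1 + (k : ℝ) ^ 2)⁻¹ ≤ 3 := by
  have hle : ∑ k ∈ Finset.range n, (1 + (k : ℝ) ^ 2)⁻¹ ≤
      1 + ∑ k ∈ Finset.Ioo 0 n, ((k : ℝ) ^ 2)⁻¹ := by
    rcases Nat.eq_zero_or_pos n with rfl | hn
    · simp
    rw [Finset.range_eq_Ico, ← Finset.add_sum_Ioo_eq_sum_Ico hn]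
    have : ∑ k ∈ Finset.Ioo 0 n, (1 + (k : ℝ) ^ 2)⁻¹ ≤
        ∑ k ∈ Finset.Ioo 0 n, ((k : ℝ) ^ 2)⁻¹ := by
      refine Finset.sum_le_sum fun k hk => ?_
      have : (0 : ℝ) < k := by exact_mod_cast (Finset.mem_Ioo.1 hk).1
      gcongr
      linarith
    simp only [Nat.cast_zero]
    norm_num
    linarith
  have := sum_Ioo_inv_sq_le (α := ℝ) 0 n
  norm_num at this
  linarith

/-- The sum of `1 / (1 + distance²)` from a point to the integers is bounded: on either side of
the point the distances dominate `0, 1, 2, …`. -/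
theorem sum_range_inv_one_add_sub_sq_le {x : ℝ} (hx : 0 ≤ x) (n : ℕ) :
    ∑ k ∈ Finset.range n, (1 + ((k : ℝ) + 1 - x) ^ 2)⁻¹ ≤ 6 := by
  set m := ⌊x⌋₊ with hm
  have hm1 : (m : ℝ) ≤ x := Nat.floor_le hx
  have hm2 : x < m + 1 := Nat.lt_floor_add_one x
  have hle : ∑ k ∈ Finset.range n, (1 + ((k : ℝ) + 1 - x) ^ 2)⁻¹ ≤
      ∑ k ∈ Finset.range (m + n), (1 + ((k : ℝ) + 1 - x) ^ 2)⁻¹ := by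
    refine Finset.sum_le_sum_of_subset_of_nonneg (Finset.range_mono (by omega)) ?_
    intro k _ _; positivity
  have hleft : ∑ k ∈ Finset.range m, (1 + ((k : ℝ) + 1 - x) ^ 2)⁻¹ ≤ 3 := by
    rw [← Finset.sum_range_reflect]
    refine le_trans (Finset.sum_le_sum fun k hk => ?_) (sum_range_inv_one_add_sq_le m)
    have hk : k + 1 ≤ m := Finset.mem_range.1 hk
    have hcast : ((m - 1 - k : ℕ) : ℝ) = m - 1 - k := by
      rw [Nat.sub_sub, Nat.cast_sub (by omega)]; push_cast; ring
    rw [hcast]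
    have : (0 : ℝ) ≤ k := by positivity
    gcongr 1
    nlinarith
  have hright : ∑ k ∈ Finset.range n, (1 + (((m + k : ℕ) : ℝ) + 1 - x) ^ 2)⁻¹ ≤ 3 := by
    refine le_trans (Finset.sum_le_sum fun k hk => ?_) (sum_range_inv_one_add_sq_le n)
    have : (0 : ℝ) ≤ k := by positivity
    push_cast
    gcongr 1
    nlinarith
  rw [Finset.sum_range_add] at hle
  linarith

theorem threshold_mem_Icc {Q : ℕ} (i : Fin Q) : (threshold i : ℝ) ∈ Set.Icc (0 : ℝ) 1 := by
  have hQ : (0 : ℝ) < Q := by exact_mod_cast i.pos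
  refine ⟨by unfold threshold; positivity, ?_⟩
  rw [threshold, div_le_one hQ]
  exact_mod_cast i.isLt

/-- Rounding `Q x` up gives a point of the grid next to `x`; `x < 1` keeps it in the grid. -/
theorem exists_threshold_near {Q : ℕ} (hQ : 0 < Q) {x : ℝ} (hx : x ∈ Set.Ioo (0 : ℝ) 1) :
    ∃ j : Fin Q, |threshold j - x| ≤ 1 / Q := by
  have hQ' : (0 : ℝ) < Q := by exact_mod_cast hQ
  have h0 : 0 ≤ Q * x := by have := hx.1; positivity
  have hfl : ⌊Q * x⌋₊ < Q := (Nat.floor_lt h0).2 (by nlinarith [hx.2])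
  refine ⟨⟨_, hfl⟩, ?_⟩
  have h1 := Nat.floor_le h0
  have h2 := Nat.lt_floor_add_one (Q * x)
  have heq : (threshold ⟨⌊Q * x⌋₊, hfl⟩ : ℝ) - x = (⌊Q * x⌋₊ + 1 - Q * x) / Q := by
    rw [threshold]; field_simp
  rw [heq, abs_div, abs_of_pos hQ']
  gcongr
  rw [abs_le]; constructor <;> linarith

/-- Over the arms whose loss `d i` is both at least `a / Q²` and at least quadratic in the distance
to `x`, the sum of `1 / d i` is of order `Q²`. -/
theorem sum_inv_loss_le {Q : ℕ} {x a c : ℝ} (hx : 0 ≤ x) (ha : 0 < a) (hc : 0 < c)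
    (s : Finset (Fin Q)) (d : Fin Q → ℝ) (hda : ∀ i ∈ s, a / (Q : ℝ) ^ 2 ≤ d i)
    (hdc : ∀ i ∈ s, c * (threshold i - x) ^ 2 ≤ d i) :
    ∑ i ∈ s, (d i)⁻¹ ≤ 12 / min a c * (Q : ℝ) ^ 2 := by
  have hb : 0 < min a c := lt_min ha hc
  have hterm : ∀ i ∈ s, (d i)⁻¹ ≤
      2 / min a c * (Q : ℝ) ^ 2 * (1 + (((i : ℕ) : ℝ) + 1 - Q * x) ^ 2)⁻¹ := by
    intro i hi
    have hQ : (0 : ℝ) < Q := by exact_mod_cast i.pos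
    have h1 := hda i hi
    have h2 := hdc i hi
    have heq : (threshold i : ℝ) - x = (((i : ℕ) : ℝ) + 1 - Q * x) / Q := by
      rw [threshold]; field_simp
    rw [heq, div_pow] at h2
    set y := (((i : ℕ) : ℝ) + 1 - Q * x) ^ 2
    have hy : 0 ≤ y := sq_nonneg _
    have h3 : min a c / 2 * (1 + y) / (Q : ℝ) ^ 2 ≤ d i := by
      have e1 : min a c / (Q : ℝ) ^ 2 ≤ a / (Q : ℝ) ^ 2 := by gcongr; exact min_le_left _ _
      have e2 : min a c * (y / (Q : ℝ) ^ 2) ≤ c * (y / (Q : ℝ) ^ 2) := by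
        gcongr; exact min_le_right _ _
      have e3 : min a c / 2 * (1 + y) / (Q : ℝ) ^ 2 =
          (min a c / (Q : ℝ) ^ 2 + min a c * (y / (Q : ℝ) ^ 2)) / 2 := by field_simp
      linarith
    calc (d i)⁻¹ ≤ (min a c / 2 * (1 + y) / (Q : ℝ) ^ 2)⁻¹ := by gcongr
      _ = _ := by field_simp
  calc ∑ i ∈ s, (d i)⁻¹
      ≤ ∑ i ∈ s, 2 / min a c * (Q : ℝ) ^ 2 * (1 + (((i : ℕ) : ℝ) + 1 - Q * x) ^ 2)⁻¹ :=
        Finset.sum_le_sum hterm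
    _ ≤ ∑ i : Fin Q, 2 / min a c * (Q : ℝ) ^ 2 * (1 + (((i : ℕ) : ℝ) + 1 - Q * x) ^ 2)⁻¹ :=
        Finset.sum_le_sum_of_subset_of_nonneg (Finset.subset_univ s) fun i _ _ => by positivity
    _ ≤ 2 / min a c * (Q : ℝ) ^ 2 * 6 := by
        rw [← Finset.mul_sum, Fin.sum_univ_eq_sum_range
          (fun k : ℕ => (1 + ((k : ℝ) + 1 - Q * x) ^ 2)⁻¹)]
        gcongr
        exact sum_range_inv_one_add_sub_sq_le (by positivity) Q
    _ = _ := by ring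

/-! ### The payoff against a myopic agent -/

theorem measurableSet_mem_bestResponses {K : ℕ} (τ : ℝ) (o : Option (Fin K)) :
    MeasurableSet {s : Profile K | o ∈ bestResponses s τ} := by
  have hX : ∀ a, Measurable fun s : Profile K => (s a).1 := fun a =>
    measurable_fst.comp (measurable_pi_apply a)
  have hY : ∀ o, Measurable fun s : Profile K => agentUtility s o := fun o => by
    cases o with
    | none => exact measurable_const
    | some a => exact measurable_snd.comp (measurable_pi_apply a)
  have hF : ∀ o, MeasurableSet {s : Profile K | o ∈ feasible s τ} := fun o => by
    cases o with
    | none => simp [feasible]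
    | some a => simpa [feasible] using measurableSet_le measurable_const (hX a)
  have heq : {s : Profile K | o ∈ bestResponses s τ} = {s | o ∈ feasible s τ} ∩
      ⋂ o', ({s | o' ∈ feasible s τ}ᶜ ∪ {s | agentUtility s o' ≤ agentUtility s o}) := by
    ext s
    simp [bestResponses, imp_iff_not_or]
  rw [heq]
  exact (hF o).inter (MeasurableSet.iInter fun o' =>
    (hF o').compl.union (measurableSet_le (hY o') (hY o)))

theorem measurable_myopicPayoff {K : ℕ} (τ : ℝ) :
    Measurable fun s : Profile K => myopicPayoff s τ := by
  have hX : ∀ o, Measurable fun s : Profile K => principalUtility s o := fun o => by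
    cases o with
    | none => exact measurable_const
    | some a => exact measurable_fst.comp (measurable_pi_apply a)
  refine measurable_of_Iio fun c => ?_
  have heq : (fun s : Profile K => myopicPayoff s τ) ⁻¹' Set.Iio c =
      ⋂ o, ({s | o ∈ bestResponses s τ}ᶜ ∪ {s | principalUtility s o < c}) := by
    ext s
    simp only [Set.mem_preimage, Set.mem_Iio, myopicPayoff, Finset.sup'_lt_iff, Set.mem_iInter,
      Set.mem_union, Set.mem_compl_iff, Set.mem_ofPred_eq, imp_iff_not_or]
  rw [heq]
  exact MeasurableSet.iInter fun o =>
    (measurableSet_mem_bestResponses τ o).compl.union (measurableSet_lt (hX o) measurable_const)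

theorem myopicPayoff_mem_Icc {K : ℕ} {s : Profile K} (hs : ∀ a, (s a).1 ∈ Set.Icc (0 : ℝ) 1)
    (τ : ℝ) : myopicPayoff s τ ∈ Set.Icc (0 : ℝ) 1 := by
  have hu : ∀ o, principalUtility s o ∈ Set.Icc (0 : ℝ) 1 := fun o => by
    cases o with
    | none => simp [principalUtility]
    | some a => exact hs a
  obtain ⟨o, ho⟩ := bestResponses_nonempty s τ
  exact ⟨(hu o).1.trans (Finset.le_sup' _ ho), Finset.sup'_le _ _ fun o _ => (hu o).2⟩

/-! ### The regret of UCB1 -/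

theorem sum_range_eq_sum_pulls {Q : ℕ} (π : Policy Q) (r : ℕ → Fin Q → ℝ) (g : Fin Q → ℝ)
    (T : ℕ) : ∑ t ∈ Finset.range T, g (π t (playHistory π r t)) =
      ∑ i, g i * pulls (playHistory π r T) i := by
  induction T with
  | zero => simp [pulls]
  | succ n ih =>
    rw [Finset.sum_range_succ, ih]
    simp [pulls_playHistory_succ, mul_add, Finset.sum_add_distrib]

section Regret

variable {Q : ℕ} {E Ω : Type*} [MeasurableSpace E] [MeasurableSpace Ω]

/-- The regret with respect to a benchmark `b` is the sum of the losses of the arms weighted with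
their expected numbers of pulls. -/
theorem sub_integral_sum_playReward_eq {μ : Measure Ω} [IsProbabilityMeasure μ] {D : Measure E}
    [IsProbabilityMeasure D] {π : Policy Q} (hπ : ∀ n, Measurable (π n))
    {ρ : Fin Q → E → ℝ} (hρ : ∀ i, Measurable (ρ i))
    (hρ01 : ∀ i, ∀ᵐ s ∂D, ρ i s ∈ Set.Icc (0 : ℝ) 1)
    {X : ℕ → Ω → E} (hX : ∀ t, Measurable (X t))
    (hind : iIndepFun X μ) (hD : ∀ t, μ.map (X t) = D) (b : ℝ) (T : ℕ) :
    T * b - ∫ ω, ∑ t ∈ Finset.range T, playReward π (fun t i => ρ i (X t ω)) t ∂μ =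
      ∑ i, (b - ∫ s, ρ i s ∂D) *
        ∫ ω, (pulls (playHistory π (fun t i => ρ i (X t ω)) T) i : ℝ) ∂μ := by
  have hpulls := fun i => integrable_pulls (μ := μ) hπ hρ hX i T
  have hsum : ∀ g : Fin Q → ℝ, ∑ i, g i *
      ∫ ω, (pulls (playHistory π (fun t i => ρ i (X t ω)) T) i : ℝ) ∂μ =
      ∑ t ∈ Finset.range T, ∫ ω, g (π t (playHistory π (fun t i => ρ i (X t ω)) t)) ∂μ := by
    intro g
    have hint : ∀ t, Integrable (fun ω => g (π t (playHistory π (fun t i => ρ i (X t ω)) t))) μ :=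
      fun t => Integrable.comp_measurable (g := g) Integrable.of_finite
        ((hπ t).comp (measurable_playHistory hπ hρ hX t))
    rw [← integral_finsetSum _ fun t _ => hint t]
    simp only [sum_range_eq_sum_pulls]
    rw [integral_finsetSum _ fun i _ => (hpulls i).const_mul (g i)]
    simp only [integral_const_mul]
  rw [integral_finsetSum _ fun t _ =>
    (integral_playReward hπ hρ hρ01 hX hind hD t).1,
    Finset.sum_congr rfl fun t _ => (integral_playReward hπ hρ hρ01 hX hind hD t).2,
    ← hsum fun i => ∫ s, ρ i s ∂D]
  have hT := hsum fun _ => b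
  simp only [integral_const, probReal_univ, one_smul, Finset.sum_const, Finset.card_range,
    nsmul_eq_mul] at hT
  rw [← hT, ← Finset.sum_sub_distrib]
  exact Finset.sum_congr rfl fun i _ => (sub_mul _ _ _).symm

/-- Regret of UCB1 with respect to a benchmark `b` that some arm `j` attains up to `ε / 2`. Arms
whose loss is below `ε` cost at most `ε` per round; every other arm `i` is worse than `j` by at
least half of its own loss, so that it is rarely pulled. -/
theorem IsUCB1.regret_le {μ : Measure Ω} [IsProbabilityMeasure μ] {D : Measure E}
    [IsProbabilityMeasure D] {π : Policy Q} (hπ : IsUCB1 π)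
    {ρ : Fin Q → E → ℝ} (hρ : ∀ i, Measurable (ρ i))
    (hρ01 : ∀ i, ∀ᵐ s ∂D, ρ i s ∈ Set.Icc (0 : ℝ) 1)
    {X : ℕ → Ω → E} (hX : ∀ t, Measurable (X t))
    (hind : iIndepFun X μ) (hD : ∀ t, μ.map (X t) = D) {b ε : ℝ} (hε : 0 < ε) {j : Fin Q}
    (hj : b - ∫ s, ρ j s ∂D ≤ ε / 2) (T : ℕ) :
    T * b - ∫ ω, ∑ t ∈ Finset.range T, playReward π (fun t i => ρ i (X t ω)) t ∂μ ≤
      T * ε + ∑ i with ε ≤ b - ∫ s, ρ i s ∂D,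
        (32 * Real.log T * (b - ∫ s, ρ i s ∂D)⁻¹ + 5 * (b - ∫ s, ρ i s ∂D)) := by
  rw [sub_integral_sum_playReward_eq hπ.measurable hρ hρ01 hX hind hD]
  set d : Fin Q → ℝ := fun i => b - ∫ s, ρ i s ∂D with hd
  set N : Fin Q → ℝ := fun i =>
    ∫ ω, (pulls (playHistory π (fun t i => ρ i (X t ω)) T) i : ℝ) ∂μ with hN
  have hN0 : ∀ i, 0 ≤ N i := fun i => integral_nonneg fun ω => by positivity
  have hNT : ∑ i, N i = T := by
    simp only [hN]
    rw [← integral_finsetSum _ fun i _ => integrable_pulls hπ.measurable hρ hX i T]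
    have h := fun ω => sum_range_eq_sum_pulls π (fun t i => ρ i (X t ω)) (fun _ => 1) T
    simp only [one_mul, Finset.sum_const, Finset.card_range, nsmul_eq_mul, mul_one] at h
    simp only [← h, integral_const, probReal_univ, one_smul]
  have hlog : 0 ≤ Real.log T := Real.log_natCast_nonneg T
  change ∑ i, d i * N i ≤ T * ε + ∑ i with ε ≤ d i, (32 * Real.log T * (d i)⁻¹ + 5 * d i)
  have hterm : ∀ i, d i * N i ≤
      ε * N i + if ε ≤ d i then 32 * Real.log T * (d i)⁻¹ + 5 * d i else 0 := by
    intro i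
    split_ifs with hi
    · have hdi : 0 < d i := hε.trans_le hi
      have hgap : d i / 2 ≤ ∫ s, ρ j s ∂D - ∫ s, ρ i s ∂D := by
        simp only [hd] at hi ⊢; linarith
      have hpull := hπ.integral_pulls_le hρ hρ01 hX hind hD (i := i) (j := j) (by linarith) T
      have hle : N i ≤ 8 * Real.log T / (d i / 2) ^ 2 + 5 := by
        refine hpull.trans ?_
        gcongr
      have h1 : d i * N i ≤ d i * (8 * Real.log T / (d i / 2) ^ 2 + 5) := by gcongr
      have h2 : d i * (8 * Real.log T / (d i / 2) ^ 2 + 5) =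
          32 * Real.log T * (d i)⁻¹ + 5 * d i := by field_simp; ring
      have := mul_nonneg hε.le (hN0 i)
      linarith
    · rw [add_zero]
      exact mul_le_mul_of_nonneg_right (not_le.1 hi).le (hN0 i)
  refine (Finset.sum_le_sum fun i _ => hterm i).trans_eq ?_
  rw [Finset.sum_add_distrib, ← Finset.mul_sum, hNT, Finset.sum_filter, mul_comm]

end Regret

/-- With `q = (T / log T)^(1/4)` the two sources of regret balance: both `T / q²` and `q² log T`
are equal to `√(T log T)`. An integer `Q` within distance `1` of `q` lies between `q / 2`
and `2 q`. -/
theorem discretization_bounds {T Q : ℕ} (hT : 2 ≤ T)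
    (hQ : |(Q : ℝ) - ((T : ℝ) / Real.log T) ^ (1 / 4 : ℝ)| < 1) :
    0 < Q ∧ (T : ℝ) / (Q : ℝ) ^ 2 ≤ 4 * √(T * Real.log T) ∧
      (Q : ℝ) ^ 2 * Real.log T ≤ 4 * √(T * Real.log T) ∧ (Q : ℝ) ≤ 8 * √(T * Real.log T) := by
  have hT' : (2 : ℝ) ≤ T := by exact_mod_cast hT
  set L := Real.log T with hL
  have hL2 : 1 / 2 ≤ L := by
    have h1 := Real.log_two_gt_d9
    have h2 : Real.log 2 ≤ L := Real.log_le_log (by norm_num) hT'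
    linarith
  have hL0 : 0 < L := by linarith
  have hLT : L ≤ T := (Real.log_le_sub_one_of_pos (by linarith)).trans (by linarith)
  set q := ((T : ℝ) / L) ^ (1 / 4 : ℝ) with hq
  have hq1 : 1 ≤ q := Real.one_le_rpow ((one_le_div hL0).2 hLT) (by norm_num)
  have hq4 : q ^ 4 = T / L := by
    rw [hq, ← Real.rpow_natCast, ← Real.rpow_mul (by positivity)]
    norm_num
  have hTq : (T : ℝ) = q ^ 4 * L := by rw [hq4]; field_simp
  have hR : √(T * L) = q ^ 2 * L := by
    rw [hTq, show q ^ 4 * L * L = (q ^ 2 * L) ^ 2 by ring]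
    exact Real.sqrt_sq (by positivity)
  obtain ⟨h1, h2⟩ := abs_lt.1 hQ
  have hQ0 : 0 < Q := by
    have : (0 : ℝ) < Q := by linarith
    exact_mod_cast this
  have hQ1 : (1 : ℝ) ≤ Q := by exact_mod_cast hQ0
  have hup : (Q : ℝ) ≤ 2 * q := by linarith
  have hlow : q ≤ 2 * Q := by linarith
  have hup2 : (Q : ℝ) ^ 2 ≤ 4 * q ^ 2 := by nlinarith
  have hlow2 : q ^ 2 ≤ 4 * (Q : ℝ) ^ 2 := by nlinarith
  refine ⟨hQ0, ?_, ?_, ?_⟩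
  · rw [hR, hTq, div_le_iff₀ (by positivity)]
    have := mul_le_mul_of_nonneg_left hlow2 (show 0 ≤ q ^ 2 * L by positivity)
    nlinarith
  · rw [hR]
    nlinarith
  · rw [hR]
    have := mul_le_mul_of_nonneg_left hL2 (show 0 ≤ q ^ 2 by positivity)
    nlinarith

end RepeatedDelegation

open RepeatedDelegation in
theorem mainTheorem4
    (f : ℝ → ℝ) (τopt : ℝ) (hτopt : τopt ∈ Set.Ioo (0 : ℝ) 1)
    (hunique : ∀ τ ∈ Set.Icc (0 : ℝ) 1, τ ≠ τopt → f τ < f τopt)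
    (husc : UpperSemicontinuousOn f (Set.Icc 0 1))
    (hdiff : ∀ᶠ τ in 𝓝 τopt, DifferentiableAt ℝ f τ)
    (hdiff₂ : DifferentiableAt ℝ (deriv f) τopt)
    (hneg : deriv (deriv f) τopt < 0) :
    ∃ C : ℝ, ∀ (K : ℕ) (D : Measure (RepeatedDelegation.Profile K)) [IsProbabilityMeasure D],
      (∀ᵐ s ∂D, ∀ a, (s a).1 ∈ Set.Icc (0 : ℝ) 1 ∧ (s a).2 ∈ Set.Icc (0 : ℝ) 1) →
      (∀ τ, RepeatedDelegation.expectedUtility D τ = f τ) →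
      ∀ (Ω : Type*) [MeasurableSpace Ω] (μ : Measure Ω) [IsProbabilityMeasure μ]
        (S : ℕ → Ω → RepeatedDelegation.Profile K),
        (∀ t, Measurable (S t)) → (∀ t, μ.map (S t) = D) → iIndepFun S μ →
        ∀ T : ℕ, 2 ≤ T →
        ∀ Q : ℕ, |(Q : ℝ) - ((T : ℝ) / Real.log T) ^ (1 / 4 : ℝ)| < 1 →
        ∀ π : RepeatedDelegation.Policy Q, RepeatedDelegation.IsUCB1 π →
          RepeatedDelegation.regret D μ S π T ≤ C * √((T : ℝ) * Real.log T) := by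
  have hmax : ∀ τ ∈ Set.Icc (0 : ℝ) 1, f τ ≤ f τopt := fun τ hτ => by
    rcases eq_or_ne τ τopt with rfl | h
    · exact le_rfl
    · exact (hunique τ hτ h).le
  have hmem : τopt ∈ Set.Icc (0 : ℝ) 1 := Set.Ioo_subset_Icc_self hτopt
  have hd0 : deriv f τopt = 0 := by
    refine IsLocalMax.deriv_eq_zero ?_
    filter_upwards [Icc_mem_nhds hτopt.1 hτopt.2] with τ hτ using hmax τ hτ
  obtain ⟨A, hA, δ, hδ, hupper⟩ := exists_forall_sub_le_mul_sq hd0 hdiff hdiff₂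
  obtain ⟨c, hc, hlower⟩ :=
    exists_forall_mul_sq_le_sub hτopt hunique husc hd0 hdiff hdiff₂ hneg
  -- The loss is at most `1`, hence at most `a` times the squared distance also away from `τopt`.
  set a := max A (δ ^ 2)⁻¹ with ha
  have ha0 : 0 < a := lt_max_of_lt_left hA
  refine ⟨8 * a + 32 * (12 / min (2 * a) c) * 4 + 40, ?_⟩
  intro K D _ hD01 hDf Ω _ μ _ S hS hlaw hind T hT Q hQ π hπ
  have hρ : ∀ i : Fin Q, Measurable fun s : Profile K => myopicPayoff s (threshold i) :=
    fun i => measurable_myopicPayoff _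
  have hae : ∀ τ, ∀ᵐ s ∂D, myopicPayoff s τ ∈ Set.Icc (0 : ℝ) 1 := fun τ => by
    filter_upwards [hD01] with s hs using myopicPayoff_mem_Icc (fun a => (hs a).1) τ
  have hf01 : ∀ τ, f τ ∈ Set.Icc (0 : ℝ) 1 := fun τ => by
    rw [← hDf τ]
    have hint : Integrable (fun s => myopicPayoff s τ) D :=
      Integrable.of_mem_Icc 0 1 (measurable_myopicPayoff τ).aemeasurable (hae τ)
    refine ⟨integral_nonneg_of_ae ((hae τ).mono fun s hs => hs.1), ?_⟩
    simpa [expectedUtility] using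
      integral_mono_ae hint (integrable_const 1) ((hae τ).mono fun s hs => hs.2)
  have hmean : ∀ i : Fin Q, ∫ s, myopicPayoff s (threshold i) ∂D = f (threshold i) :=
    fun i => hDf _
  have hsSup : sSup (expectedUtility D '' Set.Icc 0 1) = f τopt := by
    rw [funext hDf]
    exact IsGreatest.csSup_eq ⟨⟨τopt, hmem, rfl⟩, by rintro _ ⟨τ, hτ, rfl⟩; exact hmax τ hτ⟩
  have hglobal : ∀ τ, f τopt - f τ ≤ a * (τ - τopt) ^ 2 := fun τ => by
    by_cases h : |τ - τopt| < δ
    · exact (hupper τ h).trans (mul_le_mul_of_nonneg_right (le_max_left _ _) (sq_nonneg _))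
    · have h1 : δ ^ 2 ≤ (τ - τopt) ^ 2 := by
        rw [← sq_abs (τ - τopt)]
        exact pow_le_pow_left₀ hδ.le (not_lt.1 h) 2
      calc f τopt - f τ ≤ 1 := by linarith [(hf01 τopt).2, (hf01 τ).1]
        _ = (δ ^ 2)⁻¹ * δ ^ 2 := by field_simp
        _ ≤ a * (τ - τopt) ^ 2 := by gcongr; exact le_max_right _ _
  obtain ⟨hQ0, hb1, hb2, hb3⟩ := discretization_bounds hT hQ
  have hQ' : (0 : ℝ) < Q := by exact_mod_cast hQ0
  obtain ⟨j, hj⟩ := exists_threshold_near hQ0 hτopt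
  have hjgap : f τopt - f (threshold j) ≤ 2 * a / (Q : ℝ) ^ 2 / 2 := by
    have h1 : (threshold j - τopt) ^ 2 ≤ (1 / (Q : ℝ)) ^ 2 := by
      rw [← sq_abs (threshold j - τopt)]
      exact pow_le_pow_left₀ (abs_nonneg _) hj 2
    calc f τopt - f (threshold j) ≤ a * (1 / (Q : ℝ)) ^ 2 :=
          (hglobal _).trans (mul_le_mul_of_nonneg_left h1 ha0.le)
      _ = _ := by field_simp
  have hreg := hπ.regret_le hρ (fun i => hae _) hS hind hlaw (b := f τopt)
    (ε := 2 * a / (Q : ℝ) ^ 2) (by positivity) (j := j) (by rw [hmean]; exact hjgap) T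
  simp only [hmean] at hreg
  rw [regret, hsSup]
  refine hreg.trans ?_
  rw [Finset.sum_add_distrib, ← Finset.mul_sum, ← Finset.mul_sum]
  set s := Finset.univ.filter fun i : Fin Q => 2 * a / (Q : ℝ) ^ 2 ≤ f τopt - f (threshold i)
  have hinv : ∑ i ∈ s, (f τopt - f (threshold i))⁻¹ ≤ 12 / min (2 * a) c * (Q : ℝ) ^ 2 :=
    sum_inv_loss_le hmem.1 (by positivity) hc s _
      (fun i hi => (Finset.mem_filter.1 hi).2) (fun i _ => hlower _ (threshold_mem_Icc i))
  have hone : ∑ i ∈ s, (f τopt - f (threshold i)) ≤ Q := by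
    calc ∑ i ∈ s, (f τopt - f (threshold i)) ≤ ∑ i ∈ s, (1 : ℝ) :=
          Finset.sum_le_sum fun i _ => by
            linarith [(hf01 τopt).2, (hf01 (threshold i)).1]
      _ ≤ Q := by
          simp only [Finset.sum_const, nsmul_eq_mul, mul_one]
          exact_mod_cast (Finset.card_le_univ s).trans_eq (Fintype.card_fin Q)
  have hlog : 0 ≤ Real.log T := Real.log_natCast_nonneg T
  set R := √((T : ℝ) * Real.log T)
  have e1 : (T : ℝ) * (2 * a / (Q : ℝ) ^ 2) ≤ 8 * a * R := by
    calc (T : ℝ) * (2 * a / (Q : ℝ) ^ 2) = 2 * a * (T / (Q : ℝ) ^ 2) := by ring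
      _ ≤ 2 * a * (4 * R) := by gcongr
      _ = _ := by ring
  have e2 : 32 * Real.log T * ∑ i ∈ s, (f τopt - f (threshold i))⁻¹ ≤
      32 * (12 / min (2 * a) c) * 4 * R := by
    have hmin : 0 < min (2 * a) c := lt_min (by positivity) hc
    calc 32 * Real.log T * ∑ i ∈ s, (f τopt - f (threshold i))⁻¹
        ≤ 32 * Real.log T * (12 / min (2 * a) c * (Q : ℝ) ^ 2) := by gcongr
      _ = 32 * (12 / min (2 * a) c) * ((Q : ℝ) ^ 2 * Real.log T) := by ring
      _ ≤ 32 * (12 / min (2 * a) c) * (4 * R) := by gcongr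
      _ = _ := by ring
  linarith
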